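/- Let $p$ be an odd prime and let $G$ be a nontrivial finite $p$-group of nilpotency class at most two that can be generated by two elements. Write $[x,y]=x^{-1}y^{-1}xy$ and $[x,y,z]=[[x,y],z]$. Call $G$ capable if there is a group $H$ with $G\cong H/Z(H)$. Call a pair $(a,b)$ of elements of $G$ a standard pair of generators if, for some integers $\alpha,\beta,\gamma,\sigma\ge 0$ with $\alpha+\sigma\ge 2\gamma$, $\beta\ge\gamma$, $\alpha\ge\gamma\ge\sigma$, and $\alpha\ge\beta$ in case $\sigma=\gamma$, the group $G$ is presented on the generators $a,b$ by $$\left\langle a,b \;\middle|\; a^{p^{\alpha}}=b^{p^{\beta}}=[b,a]^{p^{\gamma}}=e,\ [a,b,a]=[a,b,b]=e,\ a^{p^{\alpha+\sigma-\gamma}}[b,a]^{p^{\sigma}}=e\right\rangle .$$ (For $\gamma=0$ this is the direct product of cyclic groups of orders $p^\alpha$ and $p^\beta$; the nonabelian case is $\gamma\ge 1$.) Then $G$ is capable if and only if $G$ is not cyclic and $G$ has a standard pair of generators $a,b$ of equal orders. Moreover, for every standard pair of generators $a,b$ of $G$, the group $G$ is capable if and only if $G$ is not cyclic and the orders of $a$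 and $b$ are equal. -/

import Mathlib

universe u

namespace CapableTwoGen

/-- A group `G` is capable if it is isomorphic to `H / Z(H)` for some group `H`. -/
def IsCapable (G : Type u) [Group G] : Prop :=
  ∃ (H : Type u) (_ : Group H), Nonempty (G ≃* H ⧸ Subgroup.center H)

/-- The commutator with the convention `[x, y] = x⁻¹ y⁻¹ x y`. -/
def commElt {G : Type*} [Group G] (x y : G) : G := x⁻¹ * y⁻¹ * x * y

/-- The relators of the standard presentation, in the free group on `a` (index `0`) and
`b` (index `1`): `a ^ p ^ α`, `b ^ p ^ β`, `[b, a] ^ p ^ γ`, `[a, b, a]`, `[a, b, b]` and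
`a ^ p ^ (α + σ - γ) * [b, a] ^ p ^ σ`. -/
def stdRels (p α β γ σ : ℕ) : Set (FreeGroup (Fin 2)) :=
  let a := FreeGroup.of (0 : Fin 2)
  let b := FreeGroup.of (1 : Fin 2)
  {a ^ p ^ α, b ^ p ^ β, commElt b a ^ p ^ γ, commElt (commElt a b) a, commElt (commElt a b) b,
    a ^ p ^ (α + σ - γ) * commElt b a ^ p ^ σ}

/-- The group defined by the standard presentation. -/
abbrev StdGroup (p α β γ σ : ℕ) : Type := PresentedGroup (stdRels p α β γ σ)

/-- The restrictions on the parameters of the standard presentation. The nonabelian groups are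
those with `γ ≥ 1`; for `γ = 0` (so `σ = 0`) the presentation is that of the direct product of
cyclic groups of orders `p ^ α` and `p ^ β`, with `α ≥ β`. -/
structure StdParams (α β γ σ : ℕ) : Prop where
  two_mul_le : 2 * γ ≤ α + σ
  le_beta : γ ≤ β
  le_alpha : γ ≤ α
  sigma_le : σ ≤ γ
  beta_le_alpha : σ = γ → β ≤ α

/-- `a`, `b` are the two generators in a standard presentation of `G`. -/
def IsStdPair (p : ℕ) {G : Type*} [Group G] (a b : G) : Prop :=
  ∃ α β γ σ : ℕ, StdParams α β γ σ ∧ ∃ e : StdGroup p α β γ σ ≃* G,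
    e (PresentedGroup.of 0) = a ∧ e (PresentedGroup.of 1) = b

end CapableTwoGen

/-! Write `c = [b, a]` and `r = α + σ - γ`.

Necessity: let `G = H/Z(H)` have class at most two and let `x`, `y` lift generators `a`, `b`. Then
`H` has class at most three. If `a ^ N = 1` with `N` odd, then `x ^ N` is central. Collecting `y * x
^ N` kills the `N`-th powers of `[[y, x], x]` and `[y, x]`, since `N` divides `N.choose 2`.
Collecting `x * y ^ N` then shows that `y ^ N` commutes with `x`, hence is central, so `b ^ N = 1`
(`IsCapable.pow_eq_one`). Any two generators therefore have equal orders. Applied to `1` and a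
generator of a cyclic group, this excludes nontrivial cyclic groups.

Sufficiency: a standard pair has orders `p ^ α` and `p ^ β`, so equal orders mean `α = β`. An
explicit class-three quotient of `NilThree` then has the standard group as its central quotient
(`mk_mem_center_cover`).

Existence of a standard pair: if all generating pairs have equal orders, a pair adapted to the
abelianization can be corrected to a standard pair with `α = β` (`exists_isStdPair`). -/

namespace CapableTwoGen

/-! ### A class-three group in polynomial coordinates -/

/-- A torsion-free group of nilpotency class three with underlying set `ℤ⁵`. It contains, with finite
index, the free group of class three on the elements `x` and `y` below. -/
@[ext]
structure NilThree where
  i : ℤ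
  j : ℤ
  k : ℤ
  l : ℤ
  m : ℤ

namespace NilThree

/-- With `c = [y, x]`, the element `x^i y^j c^k [c,x]^u [c,y]^v` has `l = k + 2u` and `m = k + 2v`.
Doubling and shifting these exponents removes the binomial coefficients from the product. The extra
elements have index a power of two, harmless for odd `p`. -/
instance : Mul NilThree :=
  ⟨fun g h => ⟨g.i + h.i, g.j + h.j, g.k + h.k + g.j * h.i,
    g.l + h.l + 2 * h.i * g.k + g.j * h.i ^ 2,
    g.m + h.m + 2 * h.j * g.k + h.i * g.j ^ 2 + 2 * g.j * h.j * h.i⟩⟩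

instance : One NilThree := ⟨⟨0, 0, 0, 0, 0⟩⟩

instance : Inv NilThree :=
  ⟨fun g => ⟨-g.i, -g.j, g.i * g.j - g.k, -g.l + 2 * g.i * g.k - g.j * g.i ^ 2,
    -g.m + 2 * g.j * g.k - g.i * g.j ^ 2⟩⟩

@[simp] lemma mul_i (g h : NilThree) : (g * h).i = g.i + h.i := rfl
@[simp] lemma mul_j (g h : NilThree) : (g * h).j = g.j + h.j := rfl
@[simp] lemma mul_k (g h : NilThree) : (g * h).k = g.k + h.k + g.j * h.i := rfl
@[simp] lemma mul_l (g h : NilThree) :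
    (g * h).l = g.l + h.l + 2 * h.i * g.k + g.j * h.i ^ 2 := rfl
@[simp] lemma mul_m (g h : NilThree) :
    (g * h).m = g.m + h.m + 2 * h.j * g.k + h.i * g.j ^ 2 + 2 * g.j * h.j * h.i := rfl
@[simp] lemma one_i : (1 : NilThree).i = 0 := rfl
@[simp] lemma one_j : (1 : NilThree).j = 0 := rfl
@[simp] lemma one_k : (1 : NilThree).k = 0 := rfl
@[simp] lemma one_l : (1 : NilThree).l = 0 := rfl
@[simp] lemma one_m : (1 : NilThree).m = 0 := rfl
@[simp] lemma inv_i (g : NilThree) : g⁻¹.i = -g.i := rfl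
@[simp] lemma inv_j (g : NilThree) : g⁻¹.j = -g.j := rfl
@[simp] lemma inv_k (g : NilThree) : g⁻¹.k = g.i * g.j - g.k := rfl
@[simp] lemma inv_l (g : NilThree) : g⁻¹.l = -g.l + 2 * g.i * g.k - g.j * g.i ^ 2 := rfl
@[simp] lemma inv_m (g : NilThree) : g⁻¹.m = -g.m + 2 * g.j * g.k - g.i * g.j ^ 2 := rfl

instance : Group NilThree :=
  Group.ofLeftAxioms
    (fun g h t => by ext <;> simp <;> ring)
    (fun g => by ext <;> simp)
    (fun g => by ext <;> simp <;> ring)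

/-- The first generator. -/
def x : NilThree := ⟨1, 0, 0, 0, 0⟩

/-- The second generator. -/
def y : NilThree := ⟨0, 1, 0, 0, 0⟩

lemma x_zpow (n : ℤ) : x ^ n = ⟨n, 0, 0, 0, 0⟩ := by
  induction n with
  | zero => rfl
  | succ n ih => rw [zpow_add_one, ih]; ext <;> simp [x]
  | pred n ih => rw [zpow_sub_one, ih]; ext <;> simp [x]; ring

lemma y_zpow (n : ℤ) : y ^ n = ⟨0, n, 0, 0, 0⟩ := by
  induction n with
  | zero => rfl
  | succ n ih => rw [zpow_add_one, ih]; ext <;> simp [y]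
  | pred n ih => rw [zpow_sub_one, ih]; ext <;> simp [y]; ring

lemma commElt_y_x : commElt y x = ⟨0, 0, 1, 1, 1⟩ := by
  ext <;> simp [commElt, x, y]

lemma commElt_zpow (n : ℤ) : commElt y x ^ n = ⟨0, 0, n, n, n⟩ := by
  rw [commElt_y_x]
  induction n with
  | zero => rfl
  | succ n ih => rw [zpow_add_one, ih]; ext <;> simp
  | pred n ih => rw [zpow_sub_one, ih]; ext <;> simp <;> ring

/-! ### The standard group and its cover as quotients of `NilThree` -/

/-- The preimage in `NilThree` of the trivial subgroup of the standard group. -/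
def relSubgroup (p β γ σ r : ℕ) (hβ : γ ≤ β) : Subgroup NilThree where
  carrier := {g | (p : ℤ) ^ β ∣ g.j ∧
    ∃ u : ℤ, g.i = p ^ r * u ∧ (p : ℤ) ^ γ ∣ g.k - p ^ σ * u}
  one_mem' := ⟨by simp, 0, by simp, by simp⟩
  mul_mem' := by
    rintro g h ⟨hgj, u, hgi, hgk⟩ ⟨hhj, v, hhi, hhk⟩
    refine ⟨dvd_add hgj hhj, u + v, by rw [mul_i, hgi, hhi]; ring, ?_⟩
    have h1 : (p : ℤ) ^ γ ∣ g.j * h.i := ((pow_dvd_pow _ hβ).trans hgj).mul_right _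
    rw [mul_k]
    exact ((hgk.add hhk).add h1).trans (dvd_of_eq (by ring))
  inv_mem' := by
    rintro g ⟨hgj, u, hgi, hgk⟩
    refine ⟨by simpa using hgj, -u, by rw [inv_i, hgi]; ring, ?_⟩
    have h1 : (p : ℤ) ^ γ ∣ g.i * g.j := ((pow_dvd_pow _ hβ).trans hgj).mul_left _
    rw [inv_k]
    exact (h1.sub hgk).trans (dvd_of_eq (by ring))

lemma mem_relSubgroup {p β γ σ r : ℕ} {hβ : γ ≤ β} {g : NilThree} :
    g ∈ relSubgroup p β γ σ r hβ ↔ (p : ℤ) ^ β ∣ g.j ∧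
      ∃ u : ℤ, g.i = p ^ r * u ∧ (p : ℤ) ^ γ ∣ g.k - p ^ σ * u := Iff.rfl

lemma relSubgroup_normal {p β γ σ r : ℕ} (hβ : γ ≤ β) (hr : γ ≤ r) :
    (relSubgroup p β γ σ r hβ).Normal := by
  constructor
  rintro h ⟨hj, u, hi, hk⟩ g
  refine ⟨by simpa using hj, u, by simpa using hi, ?_⟩
  have h1 : (p : ℤ) ^ γ ∣ h.j * g.i := ((pow_dvd_pow _ hβ).trans hj).mul_right _
  have h2 : (p : ℤ) ^ γ ∣ g.j * h.i := by
    rw [hi]; exact ((pow_dvd_pow _ hr).mul_right _).mul_left _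
  simp only [mul_k, inv_k, mul_j, inv_i]
  exact ((hk.add h2).sub h1).trans (dvd_of_eq (by ring))

/-- The preimage in `NilThree` of the trivial subgroup of a group whose central quotient is the
standard group. -/
def coverSubgroup (p γ σ r : ℕ) : Subgroup NilThree where
  -- These conditions are what centrality of the relators costs. Commuting `x^(p^r) c^(p^σ)` with
  -- `x` gives `[c,x]^(p^σ) = 1`, commuting it with `y` gives `c^(p^r) = [c,y]^(p^σ)`, and
  -- centrality of `c^(p^γ)` gives `[c,y]^(p^γ) = 1`. The factor 2 appears because `[c,y]` has `m =
  -- 2`.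
  carrier := {g | g.i = 0 ∧ g.j = 0 ∧ (p : ℤ) ^ σ ∣ g.l ∧
    ∃ s : ℤ, g.k = p ^ r * s ∧ (p : ℤ) ^ γ ∣ g.m + 2 * p ^ σ * s}
  one_mem' := ⟨rfl, rfl, by simp, 0, by simp, by simp⟩
  mul_mem' := by
    rintro g h ⟨hgi, hgj, hgl, u, hgk, hgm⟩ ⟨hhi, hhj, hhl, v, hhk, hhm⟩
    refine ⟨by simp [hgi, hhi], by simp [hgj, hhj], ?_, u + v, ?_, ?_⟩
    · simpa [hgj, hhi] using hgl.add hhl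
    · simp [hhi, hgk, hhk]; ring
    · simp only [mul_m, hgj, hhi, hhj]
      exact (hgm.add hhm).trans (dvd_of_eq (by ring))
  inv_mem' := by
    rintro g ⟨hgi, hgj, hgl, u, hgk, hgm⟩
    refine ⟨by simp [hgi], by simp [hgj], by simpa [hgi, hgj] using hgl, -u, ?_, ?_⟩
    · simp [hgi, hgk]
    · simp only [inv_m, hgi, hgj]
      exact (hgm.neg_right).trans (dvd_of_eq (by ring))

lemma mem_coverSubgroup {p γ σ r : ℕ} {g : NilThree} :
    g ∈ coverSubgroup p γ σ r ↔ g.i = 0 ∧ g.j = 0 ∧ (p : ℤ) ^ σ ∣ g.l ∧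
      ∃ s : ℤ, g.k = p ^ r * s ∧ (p : ℤ) ^ γ ∣ g.m + 2 * p ^ σ * s := Iff.rfl

lemma coverSubgroup_normal {p γ σ r : ℕ} (hσ : σ ≤ γ) (hr : γ ≤ r) :
    (coverSubgroup p γ σ r).Normal := by
  constructor
  rintro h ⟨hi, hj, hl, u, hk, hm⟩ g
  have h1 : (p : ℤ) ^ γ ∣ h.k := by
    rw [hk]; exact (pow_dvd_pow _ hr).mul_right _
  have h2 : (p : ℤ) ^ σ ∣ h.k := (pow_dvd_pow _ hσ).trans h1
  refine ⟨by simp [hi], by simp [hj], ?_, u, ?_, ?_⟩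
  · simp only [mul_l, inv_l, mul_k, inv_i, mul_j, hi, hj]
    exact (hl.sub (h2.mul_left (2 * g.i))).trans (dvd_of_eq (by ring))
  · simp only [mul_k, inv_k, inv_i, mul_j, hi, hj, hk]
    ring
  · simp only [mul_m, inv_m, mul_k, inv_i, inv_j, mul_j, hi, hj]
    exact (hm.sub (h1.mul_left (2 * g.j))).trans (dvd_of_eq (by ring))

/-- An element is central modulo a normal subgroup when its commutators lie in that subgroup. -/
lemma mk_mem_center_iff {N : Subgroup NilThree} [N.Normal] (g : NilThree) :
    (g : NilThree ⧸ N) ∈ Subgroup.center (NilThree ⧸ N) ↔ ∀ h : NilThree, (h * g)⁻¹ * (g * h) ∈ N := by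
  rw [Subgroup.mem_center_iff]
  constructor
  · intro H h
    rw [← QuotientGroup.eq]
    exact H h
  · intro H h
    induction h using QuotientGroup.induction_on with
    | H h => exact QuotientGroup.eq.2 (H h)

lemma comm_coords (g h : NilThree) : (h * g)⁻¹ * (g * h) =
    ⟨0, 0, g.j * h.i - h.j * g.i,
      2 * h.i * g.k - 2 * g.i * h.k + g.j * h.i ^ 2 - h.j * g.i ^ 2,
      2 * h.j * g.k - 2 * g.j * h.k + h.i * g.j ^ 2 - g.i * h.j ^ 2
        + 2 * g.j * h.j * h.i - 2 * h.j * g.j * g.i⟩ := by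
  rw [inv_mul_eq_iff_eq_mul]
  ext <;> simp <;> ring

/-- Commutators with `x` and `y` already detect the centre. The one with `x` gives `j = p^r s` with
`p^γ ∣ 2 p^σ s`, so `p^(γ-σ) ∣ s` and `p^α ∣ j`. The one with `y` gives the conditions on `i` and
`k`. Thus the exponent attached to `y` is forced to be `α`, which is why this cover serves exactly
the case `α = β`. -/
lemma mk_mem_center_cover {p α γ σ r : ℕ} (hp : p.Prime) (hodd : Odd p) (hσ : σ ≤ γ) (hr : γ ≤ r)
    (hα : γ ≤ α) (hrα : r + γ = α + σ) [(coverSubgroup p γ σ r).Normal] (g : NilThree) :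
    (g : NilThree ⧸ coverSubgroup p γ σ r) ∈ Subgroup.center (NilThree ⧸ coverSubgroup p γ σ r) ↔
      g ∈ relSubgroup p α γ σ r hα := by
  have hp0 : (p : ℤ) ≠ 0 := by exact_mod_cast hp.ne_zero
  have h2 : ∀ n : ℕ, IsCoprime ((p : ℤ) ^ n) 2 := fun n => by
    apply IsCoprime.pow_left
    rw [Int.isCoprime_iff_gcd_eq_one]
    exact_mod_cast Nat.coprime_two_right.2 hodd
  obtain ⟨d, hd⟩ : ∃ d, γ = σ + d := Nat.exists_eq_add_of_le hσ
  have hαd : α = r + d := by omega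
  rw [mk_mem_center_iff, mem_relSubgroup]
  simp only [comm_coords, mem_coverSubgroup, true_and]
  constructor
  · intro H
    obtain ⟨hl, s, hj, hm⟩ := H x
    obtain ⟨-, t, hi, hm'⟩ := H y
    simp only [x, y, one_pow, mul_one, mul_zero, zero_mul, sub_zero, add_zero, zero_sub,
      zero_add, ne_eq, OfNat.ofNat_ne_zero, not_false_eq_true, zero_pow, one_mul] at hl hj hm hi hm'
    have hγj : (p : ℤ) ^ γ ∣ g.j := hj ▸ (pow_dvd_pow _ hr).mul_right _
    have hγi : (p : ℤ) ^ γ ∣ g.i := by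
      rw [← dvd_neg, hi]; exact (pow_dvd_pow _ hr).mul_right _
    constructor
    · have h3 : (p : ℤ) ^ γ ∣ 2 * (p ^ σ * s) := by
        exact (hm.sub (hγj.mul_right g.j)).trans (dvd_of_eq (by ring))
      have h4 := (h2 γ).dvd_of_dvd_mul_left h3
      rw [hd, pow_add] at h4
      have h5 := Int.dvd_of_mul_dvd_mul_left (pow_ne_zero _ hp0) h4
      rw [hj, hαd, pow_add]
      exact mul_dvd_mul_left _ h5
    · refine ⟨-t, by linear_combination -hi, (h2 γ).dvd_of_dvd_mul_left ?_⟩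
      exact ((hm'.add hγi).add (hγi.mul_right (2 * g.j))).trans (dvd_of_eq (by ring))
  · rintro ⟨⟨v, hv⟩, u, hi, hk⟩ h
    have hγj : (p : ℤ) ^ γ ∣ g.j := hv ▸ (pow_dvd_pow _ hα).mul_right _
    have hγi : (p : ℤ) ^ γ ∣ g.i := hi ▸ (pow_dvd_pow _ hr).mul_right _
    have hσγ : (p : ℤ) ^ σ ∣ (p : ℤ) ^ γ := pow_dvd_pow _ hσ
    have hσk : (p : ℤ) ^ σ ∣ g.k := by
      have := (hσγ.trans hk).add (Dvd.intro u rfl : (p : ℤ) ^ σ ∣ p ^ σ * u)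
      simpa using this
    obtain ⟨i', hi'⟩ := hγi
    obtain ⟨j', hj'⟩ := hγj
    obtain ⟨k', hk'⟩ := hσk
    obtain ⟨t, ht⟩ := hσγ
    obtain ⟨w, hw⟩ := hk
    -- The witnesses are the coordinates in `comm_coords` divided by `p^σ`, `p^r` and, after adding
    -- `2 p^σ s`, by `p^γ`.
    refine ⟨⟨2 * h.i * k' - 2 * (t * i') * h.k + (t * j') * h.i ^ 2 - h.j * (t * i') * g.i, ?_⟩,
      p ^ d * v * h.i - h.j * u, ?_, ?_⟩
    · rw [hk', hj']
      linear_combination (j' * h.i ^ 2) * ht - (2 * h.k + h.j * g.i) * (hi' + i' * ht)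
    · rw [hv, hi, hαd, pow_add]; ring
    · refine ⟨2 * h.j * w - 2 * j' * h.k + h.i * j' * g.j - i' * h.j ^ 2 + 2 * j' * h.j * h.i
        - 2 * h.j * g.j * i' + 2 * v * h.i, ?_⟩
      have e : (p : ℤ) ^ γ = p ^ σ * p ^ d := by rw [hd, pow_add]
      linear_combination (2 * h.j) * hw + (-2 * h.k + h.i * g.j + 2 * h.j * h.i) * hj'
        - (h.j ^ 2 + 2 * h.j * g.j) * hi' - 2 * v * h.i * e

/-- `x` and `y` do not generate `NilThree`, but `relSubgroup` ignores `l` and `m`, so their images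
generate the quotient. -/
lemma mk_eq {β γ σ r p : ℕ} {hβ : γ ≤ β} [(relSubgroup p β γ σ r hβ).Normal] (g : NilThree) :
    (g : NilThree ⧸ relSubgroup p β γ σ r hβ) = (x : NilThree ⧸ relSubgroup p β γ σ r hβ) ^ g.i *
      (y : NilThree ⧸ relSubgroup p β γ σ r hβ) ^ g.j *
      (commElt y x : NilThree ⧸ relSubgroup p β γ σ r hβ) ^ g.k := by
  change _ = (((x ^ g.i * y ^ g.j * commElt y x ^ g.k : NilThree)) :
    NilThree ⧸ relSubgroup p β γ σ r hβ)
  rw [QuotientGroup.eq, x_zpow, y_zpow, commElt_zpow]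
  exact ⟨by simp, 0, by simp, by simp [mul_comm]⟩

lemma zpow_mul_zpow_mul_zpow (i j k : ℤ) :
    x ^ i * y ^ j * commElt y x ^ k = ⟨i, j, k, k, k⟩ := by
  rw [x_zpow, y_zpow, commElt_zpow]
  ext <;> simp

end NilThree
-- Commutator calculus in class two
section ClassTwo

variable {G : Type*} [Group G]

lemma commElt_eq_one_iff {x y : G} : commElt x y = 1 ↔ Commute x y := by
  have h : commElt x y = (y * x)⁻¹ * (x * y) := by simp [commElt, mul_assoc]
  rw [h, inv_mul_eq_one, eq_comm, commute_iff_eq]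

lemma commElt_inv (x y : G) : (commElt x y)⁻¹ = commElt y x := by
  simp [commElt, mul_assoc]

lemma map_commElt {H : Type*} [Group H] (f : G →* H) (x y : G) :
    f (commElt x y) = commElt (f x) (f y) := by
  simp [commElt]

lemma mul_eq_mul_commElt (a b : G) : b * a = a * b * commElt b a := by
  simp [commElt, mul_assoc]

lemma zpow_mul_zpow_eq {a b : G} (hc : ∀ g, Commute (commElt b a) g) (i j : ℤ) :
    b ^ j * a ^ i = a ^ i * b ^ j * commElt b a ^ (i * j) := by
  have h1 : b⁻¹ * a * b = a * (commElt b a)⁻¹ := by simp [commElt, mul_assoc]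
  have h2 : b⁻¹ * a ^ i * b = a ^ i * (commElt b a) ^ (-i) := by
    have := congrArg (· ^ i) h1
    simp only [((hc a).inv_left.symm).mul_zpow] at this
    rw [zpow_neg, ← inv_zpow, ← this]
    simpa using (conj_zpow (a := b⁻¹) (b := a) (i := i)).symm
  have h3 : (a ^ i)⁻¹ * b * a ^ i = b * (commElt b a) ^ i := by
    have h4 : a ^ i * b = b * (a ^ i * (commElt b a) ^ (-i)) := by rw [← h2]; group
    rw [zpow_neg, ← mul_assoc, eq_mul_inv_iff_mul_eq] at h4
    rw [mul_assoc, ← h4, mul_assoc, inv_mul_cancel_left]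
  have h5 : (a ^ i)⁻¹ * b ^ j * a ^ i = b ^ j * (commElt b a) ^ (i * j) := by
    have := congrArg (· ^ j) h3
    simp only [(((hc b).zpow_left i).symm).mul_zpow] at this
    rw [zpow_mul, ← this]
    simpa using (conj_zpow (a := (a ^ i)⁻¹) (b := b) (i := j)).symm
  rw [mul_assoc, ← h5]; group

lemma mul_pow_eq {a b : G} (hc : ∀ g, Commute (commElt b a) g) (n : ℕ) :
    (a * b) ^ n = a ^ n * b ^ n * commElt b a ^ (n.choose 2) := by
  induction n with
  | zero => simp
  | succ n ih =>
    have h := zpow_mul_zpow_eq hc 1 n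
    rw [zpow_one, zpow_natCast, one_mul, zpow_natCast] at h
    rw [pow_succ, ih, Nat.choose_succ_succ' n 1, Nat.choose_one_right, pow_add,
      mul_assoc (a ^ n * b ^ n), ((hc (a * b)).pow_left _).eq, pow_succ a, pow_succ b]
    calc a ^ n * b ^ n * (a * b * commElt b a ^ n.choose 2)
        = a ^ n * (b ^ n * a) * b * commElt b a ^ n.choose 2 := by group
      _ = a ^ n * a * b ^ n * (commElt b a ^ n * b) * commElt b a ^ n.choose 2 := by
          rw [h]; group
      _ = _ := by rw [((hc b).pow_left n).eq]; group

lemma exists_eq_zpow_mul {a b : G} (hgen : Subgroup.closure {a, b} = ⊤)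
    (hc : ∀ g, Commute (commElt b a) g) (g : G) :
    ∃ i j k : ℤ, g = a ^ i * b ^ j * commElt b a ^ k := by
  have hg : g ∈ Subgroup.closure {a, b} := hgen ▸ Subgroup.mem_top g
  induction hg using Subgroup.closure_induction with
  | mem x hx =>
    rcases hx with rfl | rfl
    · exact ⟨1, 0, 0, by simp⟩
    · exact ⟨0, 1, 0, by simp⟩
  | one => exact ⟨0, 0, 0, by simp⟩
  | mul x y _ _ hx hy =>
    obtain ⟨i, j, k, rfl⟩ := hx
    obtain ⟨i', j', k', rfl⟩ := hy
    refine ⟨i + i', j + j', i' * j + k + k', ?_⟩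
    calc a ^ i * b ^ j * commElt b a ^ k * (a ^ i' * b ^ j' * commElt b a ^ k')
        = a ^ i * b ^ j * (commElt b a ^ k * (a ^ i' * b ^ j')) * commElt b a ^ k' := by group
      _ = a ^ i * (b ^ j * a ^ i') * b ^ j' * commElt b a ^ k * commElt b a ^ k' := by
          rw [((hc (a ^ i' * b ^ j')).zpow_left k).eq]; group
      _ = a ^ i * a ^ i' * b ^ j * (commElt b a ^ (i' * j) * b ^ j') * commElt b a ^ k *
            commElt b a ^ k' := by rw [zpow_mul_zpow_eq hc]; group
      _ = _ := by rw [((hc (b ^ j')).zpow_left _).eq]; simp only [zpow_add]; group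
  | inv x _ hx =>
    obtain ⟨i, j, k, rfl⟩ := hx
    refine ⟨-i, -j, i * j - k, ?_⟩
    have h := zpow_mul_zpow_eq hc (-i) (-j)
    rw [mul_inv_rev, mul_inv_rev, ← zpow_neg, ← zpow_neg, ← zpow_neg, h,
      ((hc _).zpow_left _).eq, neg_mul_neg, mul_assoc, ← zpow_add, sub_eq_add_neg]

/-- An element commuting with both generators is central. -/
lemma commute_of_closure {a b c : G} (hgen : Subgroup.closure {a, b} = ⊤)
    (ha : Commute c a) (hb : Commute c b) (g : G) : Commute c g := by
  have hg : g ∈ Subgroup.closure {a, b} := hgen ▸ Subgroup.mem_top g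
  induction hg using Subgroup.closure_induction with
  | mem x hx => rcases hx with rfl | rfl <;> assumption
  | one => exact Commute.one_right c
  | mul x y _ _ hx hy => exact hx.mul_right hy
  | inv x _ hx => exact hx.inv_right

end ClassTwo

/-! ### The standard presentation and its universal property -/

lemma StdGroup.closure_eq_top (p α β γ σ : ℕ) :
    Subgroup.closure {(PresentedGroup.of 0 : StdGroup p α β γ σ), PresentedGroup.of 1} = ⊤ := by
  rw [← PresentedGroup.closure_range_of (stdRels p α β γ σ)]
  congr 1
  ext z
  simp [Fin.exists_fin_two, eq_comm]

lemma forall_stdRels {p α β γ σ : ℕ} {P : FreeGroup (Fin 2) → Prop} :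
    (∀ r ∈ stdRels p α β γ σ, P r) ↔
      P (FreeGroup.of 0 ^ p ^ α) ∧ P (FreeGroup.of 1 ^ p ^ β) ∧
      P (commElt (FreeGroup.of 1) (FreeGroup.of 0) ^ p ^ γ) ∧
      P (commElt (commElt (FreeGroup.of 0) (FreeGroup.of 1)) (FreeGroup.of 0)) ∧
      P (commElt (commElt (FreeGroup.of 0) (FreeGroup.of 1)) (FreeGroup.of 1)) ∧
      P (FreeGroup.of 0 ^ p ^ (α + σ - γ) *
        commElt (FreeGroup.of 1) (FreeGroup.of 0) ^ p ^ σ) := by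
  simp only [stdRels, Set.mem_insert_iff, Set.mem_singleton_iff, forall_eq_or_imp, forall_eq]

/-- The defining relations of the standard presentation, read in a group. -/
structure StdRelations (p α β γ σ : ℕ) {G : Type*} [Group G] (a b : G) : Prop where
  pow_a : a ^ p ^ α = 1
  pow_b : b ^ p ^ β = 1
  pow_c : commElt b a ^ p ^ γ = 1
  central_a : Commute (commElt b a) a
  central_b : Commute (commElt b a) b
  pow_a_mul : a ^ p ^ (α + σ - γ) * commElt b a ^ p ^ σ = 1

lemma stdRelations_stdGroup (p α β γ σ : ℕ) : StdRelations p α β γ σ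
    (PresentedGroup.of 0 : StdGroup p α β γ σ) (PresentedGroup.of 1) := by
  have key : ∀ r ∈ stdRels p α β γ σ, PresentedGroup.mk (stdRels p α β γ σ) r = 1 :=
    fun r hr => PresentedGroup.one_of_mem hr
  rw [forall_stdRels] at key
  simp only [map_mul, map_pow, map_commElt] at key
  obtain ⟨h1, h2, h3, h4, h5, h6⟩ := key
  rw [commElt_eq_one_iff, ← Commute.inv_left_iff, commElt_inv] at h4 h5
  exact ⟨h1, h2, h3, h4, h5, h6⟩

/-- The homomorphism from the standard group given by two elements satisfying the relations. -/
def StdRelations.lift {p α β γ σ : ℕ} {G : Type*} [Group G] {a b : G}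
    (h : StdRelations p α β γ σ a b) : StdGroup p α β γ σ →* G :=
  PresentedGroup.toGroup (f := ![a, b]) (by
    rw [forall_stdRels]
    simp only [map_mul, map_pow, map_commElt, FreeGroup.lift_apply_of, Matrix.cons_val_zero,
      Matrix.cons_val_one]
    refine ⟨h.pow_a, h.pow_b, h.pow_c, ?_, ?_, h.pow_a_mul⟩ <;>
      rw [commElt_eq_one_iff, ← Commute.inv_left_iff, commElt_inv]
    exacts [h.central_a, h.central_b])

lemma StdRelations.lift_zero {p α β γ σ : ℕ} {G : Type*} [Group G] {a b : G}
    (h : StdRelations p α β γ σ a b) : h.lift (PresentedGroup.of 0) = a :=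
  PresentedGroup.toGroup.of _

lemma StdRelations.lift_one {p α β γ σ : ℕ} {G : Type*} [Group G] {a b : G}
    (h : StdRelations p α β γ σ a b) : h.lift (PresentedGroup.of 1) = b :=
  PresentedGroup.toGroup.of _

lemma zpow_eq_one_of_dvd {G : Type*} [Group G] {g : G} {n : ℕ} (hg : g ^ n = 1) {m : ℤ}
    (h : (n : ℤ) ∣ m) : g ^ m = 1 := by
  obtain ⟨k, rfl⟩ := h
  rw [zpow_mul, zpow_natCast, hg, one_zpow]

lemma StdRelations.zpow_mul_eq {p α β γ σ : ℕ} {G : Type*} [Group G] {a b : G}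
    (h : StdRelations p α β γ σ a b) (i k : ℤ) {j : ℤ} (hj : ((p ^ β : ℕ) : ℤ) ∣ j) :
    a ^ (((p ^ (α + σ - γ) : ℕ) : ℤ) * i) * b ^ j * commElt b a ^ k =
      commElt b a ^ (k - (p ^ σ : ℕ) * i) := by
  rw [zpow_eq_one_of_dvd h.pow_b hj, mul_one, zpow_mul, zpow_natCast,
    eq_inv_of_mul_eq_one_left h.pow_a_mul, ← zpow_natCast (commElt b a), ← zpow_neg, ← zpow_mul,
    ← zpow_add]
  congr 1
  ring

/-- Two generators satisfying the relations, in a group with the normal form of the standard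
group, give an isomorphism from the standard group. -/
lemma StdRelations.exists_mulEquiv {p α β γ σ : ℕ} {G : Type*} [Group G] {a b : G}
    (h : StdRelations p α β γ σ a b) (hgen : Subgroup.closure {a, b} = ⊤)
    (hab : ∀ i j k : ℤ, a ^ i * b ^ j * commElt b a ^ k = 1 →
      ((p ^ (α + σ - γ) : ℕ) : ℤ) ∣ i ∧ ((p ^ β : ℕ) : ℤ) ∣ j)
    (hc : ∀ k : ℤ, commElt b a ^ k = 1 → ((p ^ γ : ℕ) : ℤ) ∣ k) :
    ∃ e : StdGroup p α β γ σ ≃* G, e (PresentedGroup.of 0) = a ∧ e (PresentedGroup.of 1) = b := by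
  have hinj : Function.Injective h.lift := by
    rw [injective_iff_map_eq_one]
    intro z hz
    have hS := stdRelations_stdGroup p α β γ σ
    have hcS := commute_of_closure (StdGroup.closure_eq_top p α β γ σ) hS.central_a hS.central_b
    obtain ⟨i, j, k, rfl⟩ := exists_eq_zpow_mul (StdGroup.closure_eq_top p α β γ σ) hcS z
    have hz' : a ^ i * b ^ j * commElt b a ^ k = 1 := by
      simpa only [map_mul, map_zpow, map_commElt, h.lift_zero, h.lift_one] using hz
    -- Once `p^r ∣ i` and `p^β ∣ j`, the relations collapse the normal form to a power of the
    -- commutator, on which injectivity is the hypothesis `hc`.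
    obtain ⟨⟨i', rfl⟩, hj⟩ := hab i j k hz'
    rw [hS.zpow_mul_eq i' k hj]
    refine zpow_eq_one_of_dvd hS.pow_c (hc _ ?_)
    rw [← h.zpow_mul_eq i' k hj, hz']
  have hsurj : Function.Surjective h.lift := by
    rw [← MonoidHom.range_eq_top, eq_top_iff, ← hgen, Subgroup.closure_le]
    rintro z (rfl | rfl)
    exacts [⟨_, h.lift_zero⟩, ⟨_, h.lift_one⟩]
  exact ⟨MulEquiv.ofBijective h.lift ⟨hinj, hsurj⟩, h.lift_zero, h.lift_one⟩

/-! ### Orders of the standard generators and sufficiency -/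

open NilThree

/-- The quotient of `NilThree` that models the standard group. -/
lemma StdParams.exists_mulEquiv {p α β γ σ : ℕ} (hp : p ≠ 0) (h : StdParams α β γ σ)
    [(relSubgroup p β γ σ (α + σ - γ) h.le_beta).Normal] :
    ∃ e : StdGroup p α β γ σ ≃* NilThree ⧸ relSubgroup p β γ σ (α + σ - γ) h.le_beta,
      e (PresentedGroup.of 0) = (x : NilThree) ∧ e (PresentedGroup.of 1) = (y : NilThree) := by
  set L := relSubgroup p β γ σ (α + σ - γ) h.le_beta with hL
  have := h.two_mul_le
  have := h.sigma_le
  have := h.le_alpha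
  obtain ⟨d, hd⟩ : ∃ d, γ = σ + d := Nat.exists_eq_add_of_le h.sigma_le
  have hmk : ∀ i j k : ℤ, (x : NilThree ⧸ L) ^ i * (y : NilThree ⧸ L) ^ j *
      (commElt y x : NilThree ⧸ L) ^ k = 1 ↔ (p : ℤ) ^ β ∣ j ∧
      ∃ u : ℤ, i = p ^ (α + σ - γ) * u ∧ (p : ℤ) ^ γ ∣ k - p ^ σ * u := by
    intro i j k
    change (((x ^ i * y ^ j * commElt y x ^ k : NilThree)) : NilThree ⧸ L) = 1 ↔ _
    rw [QuotientGroup.eq_one_iff, zpow_mul_zpow_mul_zpow]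
    exact Iff.rfl
  have hcen : ∀ g : NilThree, Commute (commElt y x : NilThree ⧸ L) (g : NilThree ⧸ L) := by
    intro g
    change ((commElt y x * g : NilThree) : NilThree ⧸ L) = ((g * commElt y x : NilThree) : NilThree ⧸ L)
    rw [QuotientGroup.eq, commElt_y_x, comm_coords]
    exact ⟨by simp, 0, by simp, by simp⟩
  refine StdRelations.exists_mulEquiv ⟨?_, ?_, ?_, hcen x, hcen y, ?_⟩ ?_ ?_ ?_
  -- The witness is `u = p^d` with `d = γ - σ`: `p^α = p^r p^d` and `p^σ p^d = p^γ`.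
  · have := (hmk (p ^ α : ℕ) 0 0).2 ⟨by simp, p ^ d, ?_, ?_⟩
    · simpa only [zpow_zero, mul_one, zpow_natCast] using this
    · rw [← pow_add]; push_cast; congr 1; omega
    · rw [← pow_add, ← hd]; simp
  · have := (hmk 0 (p ^ β : ℕ) 0).2 ⟨by simp, 0, by simp, by simp⟩
    simpa only [zpow_zero, mul_one, one_mul, zpow_natCast] using this
  · have := (hmk 0 0 (p ^ γ : ℕ)).2 ⟨by simp, 0, by simp, by simp⟩
    simpa only [zpow_zero, mul_one, one_mul, zpow_natCast] using this
  · have := (hmk (p ^ (α + σ - γ) : ℕ) 0 (p ^ σ : ℕ)).2 ⟨by simp, 1, by simp, by simp⟩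
    simpa only [zpow_zero, mul_one, one_mul, zpow_natCast] using this
  · rw [eq_top_iff]
    rintro g -
    induction g using QuotientGroup.induction_on with
    | H g =>
      have hx : (x : NilThree ⧸ L) ∈ Subgroup.closure {(x : NilThree ⧸ L), (y : NilThree ⧸ L)} :=
        Subgroup.subset_closure (by simp)
      have hy : (y : NilThree ⧸ L) ∈ Subgroup.closure {(x : NilThree ⧸ L), (y : NilThree ⧸ L)} :=
        Subgroup.subset_closure (by simp)
      rw [mk_eq g]
      refine mul_mem (mul_mem (zpow_mem hx _) (zpow_mem hy _)) (zpow_mem ?_ _)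
      exact mul_mem (mul_mem (mul_mem (inv_mem hy) (inv_mem hx)) hy) hx
  · intro i j k hijk
    obtain ⟨hj, u, hi, -⟩ := (hmk i j k).1 hijk
    exact ⟨⟨u, by rw [hi]; push_cast; rfl⟩, by exact_mod_cast hj⟩
  · intro k hk
    obtain ⟨-, u, hi, hu⟩ := (hmk 0 0 k).1 (by simpa using hk)
    have hu0 : u = 0 := by simpa [hp] using hi
    subst hu0
    simpa using hu

lemma StdParams.relSubgroup_normal {p α β γ σ : ℕ} (h : StdParams α β γ σ) :
    (relSubgroup p β γ σ (α + σ - γ) h.le_beta).Normal :=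
  NilThree.relSubgroup_normal _ (by have := h.two_mul_le; omega)

/-- If `x^n` is trivial in the model, then `n = p^r u` with `p^γ ∣ p^σ u`, so `p^(γ-σ)` divides `u`
and `p^α` divides `n`. -/
lemma StdParams.orderOf_fst {p α β γ σ : ℕ} (hp : p ≠ 0) (h : StdParams α β γ σ) :
    orderOf (PresentedGroup.of 0 : StdGroup p α β γ σ) = p ^ α := by
  have := h.relSubgroup_normal (p := p)
  obtain ⟨e, hx, -⟩ := h.exists_mulEquiv hp
  obtain ⟨d, hd⟩ : ∃ d, γ = σ + d := Nat.exists_eq_add_of_le h.sigma_le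
  have h2 := h.two_mul_le
  refine Nat.dvd_antisymm (orderOf_dvd_of_pow_eq_one (stdRelations_stdGroup ..).pow_a) ?_
  have h1 : (x ^ (orderOf (PresentedGroup.of 0 : StdGroup p α β γ σ)) : NilThree) ∈
      relSubgroup p β γ σ (α + σ - γ) h.le_beta := by
    rw [← QuotientGroup.eq_one_iff, QuotientGroup.mk_pow, ← hx, ← map_pow, pow_orderOf_eq_one,
      map_one]
  rw [← zpow_natCast, x_zpow] at h1
  obtain ⟨-, u, hu, hk⟩ := h1
  simp only [zero_sub, dvd_neg] at hu hk
  rw [hd, pow_add] at hk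
  have h3 := Int.dvd_of_mul_dvd_mul_left (pow_ne_zero _ (by exact_mod_cast hp)) hk
  have h4 : p ^ α = p ^ (α + σ - γ) * p ^ d := by rw [← pow_add]; congr 1; omega
  rw [← Int.natCast_dvd_natCast, hu, h4]
  push_cast
  exact mul_dvd_mul_left _ h3

lemma StdParams.orderOf_snd {p α β γ σ : ℕ} (hp : p ≠ 0) (h : StdParams α β γ σ) :
    orderOf (PresentedGroup.of 1 : StdGroup p α β γ σ) = p ^ β := by
  have := h.relSubgroup_normal (p := p)
  obtain ⟨e, -, hy⟩ := h.exists_mulEquiv hp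
  refine Nat.dvd_antisymm (orderOf_dvd_of_pow_eq_one (stdRelations_stdGroup ..).pow_b) ?_
  have h1 : (y ^ (orderOf (PresentedGroup.of 1 : StdGroup p α β γ σ)) : NilThree) ∈
      relSubgroup p β γ σ (α + σ - γ) h.le_beta := by
    rw [← QuotientGroup.eq_one_iff, QuotientGroup.mk_pow, ← hy, ← map_pow, pow_orderOf_eq_one,
      map_one]
  rw [← zpow_natCast, y_zpow] at h1
  exact Int.natCast_dvd_natCast.1 (by push_cast; exact h1.1)

/-- The lift by `ULift` brings the concrete cover into the universe of `G`, as `IsCapable` requires.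
-/
lemma isCapable_of_surjective {H : Type} [Group H] {G : Type u} [Group G] (f : H →* G)
    (hf : Function.Surjective f) (hker : f.ker = Subgroup.center H) : IsCapable G := by
  let φ : ULift.{u} H →* G := f.comp MulEquiv.ulift.toMonoidHom
  have hφ : Function.Surjective φ := hf.comp MulEquiv.ulift.surjective
  have hk : φ.ker = Subgroup.center (ULift.{u} H) := by
    ext ⟨h⟩
    change h ∈ f.ker ↔ _
    rw [hker, Subgroup.mem_center_iff, Subgroup.mem_center_iff, ULift.forall]
    exact forall_congr' fun g => ULift.up_inj.symm
  exact ⟨ULift.{u} H, inferInstance, ⟨((QuotientGroup.quotientMulEquivOfEq hk).symm.trans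
    (QuotientGroup.quotientKerEquivOfSurjective φ hφ)).symm⟩⟩

/-- The standard group with `α = β` is capable. -/
lemma StdParams.isCapable {p α γ σ : ℕ} (hp : p.Prime) (hodd : Odd p) (h : StdParams α α γ σ)
    {G : Type u} [Group G] (e : StdGroup p α α γ σ ≃* G) : IsCapable G := by
  have hL := h.relSubgroup_normal (p := p)
  have h2 := h.two_mul_le
  have hK := coverSubgroup_normal (p := p) (r := α + σ - γ) h.sigma_le (by omega)
  obtain ⟨e', -, -⟩ := h.exists_mulEquiv hp.ne_zero
  have hcen := mk_mem_center_cover hp hodd (r := α + σ - γ) h.sigma_le (by omega) h.le_beta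
    (by omega)
  set K := coverSubgroup p γ σ (α + σ - γ)
  set L := relSubgroup p α γ σ (α + σ - γ) h.le_beta
  have hKL : K ≤ L := fun g hg => (hcen g).1 (by
    rw [(QuotientGroup.eq_one_iff g).2 hg]; exact one_mem _)
  let f : NilThree ⧸ K →* NilThree ⧸ L :=
    QuotientGroup.map K L (MonoidHom.id _) hKL
  refine isCapable_of_surjective ((e'.symm.trans e).toMonoidHom.comp f) ?_ ?_
  · refine (e'.symm.trans e).surjective.comp fun g => ?_
    induction g using QuotientGroup.induction_on with
    | H g => exact ⟨(g : NilThree ⧸ K), rfl⟩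
  · ext g
    induction g using QuotientGroup.induction_on with
    | H g =>
      rw [hcen, MonoidHom.mem_ker]
      change (e'.symm.trans e) (g : NilThree ⧸ L) = 1 ↔ _
      rw [map_eq_one_iff _ (e'.symm.trans e).injective, QuotientGroup.eq_one_iff]

/-! ### Collection in class three -/

section ThreeStep

variable {H : Type*} [Group H]

/-- Collection of `y * x ^ n` in a group of class three. -/
lemma mul_pow_collect {x y c d : H} (hxy : y * x = x * y * c) (hcx : c * x = x * c * d)
    (hd : ∀ h, Commute d h) (n : ℕ) :
    c * x ^ n = x ^ n * c * d ^ n ∧ c ^ n * x = x * c ^ n * d ^ n ∧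
      y * x ^ n = x ^ n * y * c ^ n * d ^ n.choose 2 := by
  have h1 : ∀ n : ℕ, c * x ^ n = x ^ n * c * d ^ n := by
    intro n
    induction n with
    | zero => simp
    | succ n ih =>
      calc c * x ^ (n + 1) = (c * x ^ n) * x := by rw [pow_succ, mul_assoc]
        _ = x ^ n * c * (d ^ n * x) := by rw [ih, mul_assoc]
        _ = x ^ n * (c * x) * d ^ n := by rw [((hd x).pow_left n).eq]; group
        _ = _ := by rw [hcx]; simp only [pow_succ' d, pow_succ x, mul_assoc]
  have h2 : ∀ n : ℕ, c ^ n * x = x * c ^ n * d ^ n := by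
    intro n
    induction n with
    | zero => simp
    | succ n ih =>
      calc c ^ (n + 1) * x = c * (c ^ n * x) := by rw [pow_succ', mul_assoc]
        _ = (c * x) * c ^ n * d ^ n := by rw [ih]; group
        _ = x * c * (d * c ^ n) * d ^ n := by rw [hcx]; group
        _ = _ := by
          rw [(hd (c ^ n)).eq]; simp only [pow_succ' d, pow_succ' c, mul_assoc]
  refine ⟨h1 n, h2 n, ?_⟩
  induction n with
  | zero => simp
  | succ n ih =>
    calc y * x ^ (n + 1) = (y * x ^ n) * x := by rw [pow_succ, mul_assoc]
      _ = x ^ n * y * c ^ n * (d ^ n.choose 2 * x) := by rw [ih, mul_assoc]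
      _ = x ^ n * y * (c ^ n * x) * d ^ n.choose 2 := by
        rw [((hd x).pow_left _).eq]; group
      _ = x ^ n * (y * x) * c ^ n * d ^ n * d ^ n.choose 2 := by rw [h2]; group
      _ = _ := by
        rw [hxy, Nat.choose_succ_succ' n 1, Nat.choose_one_right, pow_add d n]
        simp only [pow_succ' c, pow_succ x, mul_assoc]

lemma pow_choose_two_eq_one {d : H} {N : ℕ} (hN : Odd N) (hd : d ^ N = 1) :
    d ^ N.choose 2 = 1 := by
  obtain ⟨k, rfl⟩ := hN
  have : (2 * k + 1).choose 2 = (2 * k + 1) * k := by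
    rw [Nat.choose_two_right]
    apply Nat.div_eq_of_eq_mul_left two_pos
    simp; ring
  rw [this, pow_mul, hd, one_pow]

/-- If an odd power of `x` commutes with `y` and `⁅y, x⁆`, the same power of `y` commutes with
`x`. -/
lemma commute_pow_of_commute_pow {x y : H} (hd : ∀ h, Commute (commElt (commElt y x) x) h)
    (he : ∀ h, Commute (commElt (commElt y x) y) h) {N : ℕ} (hN : Odd N)
    (hx : ∀ h, Commute (x ^ N) h) : Commute (y ^ N) x := by
  obtain ⟨h1, -, h2⟩ := mul_pow_collect (mul_eq_mul_commElt x y)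
    (mul_eq_mul_commElt x (commElt y x)) hd N
  -- Since `x ^ N` is central, the two sides of the collection formula differ only by this power.
  have hdN : commElt (commElt y x) x ^ N = 1 := by
    rw [← (hx _).eq] at h1
    exact (mul_eq_left.1 h1.symm)
  rw [pow_choose_two_eq_one hN hdN, mul_one, ← (hx _).eq] at h2
  have hcN : commElt y x ^ N = 1 := mul_eq_left.1 h2.symm
  have hcy : (commElt y x)⁻¹ * y = y * (commElt y x)⁻¹ * (commElt (commElt y x) y)⁻¹ := by
    rw [inv_mul_eq_iff_eq_mul]
    calc y = y * commElt y x * commElt (commElt y x) y * (commElt (commElt y x) y)⁻¹ *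
          (commElt y x)⁻¹ := by group
      _ = commElt y x * y * ((commElt (commElt y x) y)⁻¹ * (commElt y x)⁻¹) := by
        rw [← mul_eq_mul_commElt]; group
      _ = _ := by rw [((he _).inv_left).eq]; group
  have hxy : x * y = y * x * (commElt y x)⁻¹ := by
    rw [commElt_inv, ← mul_eq_mul_commElt]
  -- Collection with the roles of `x` and `y` exchanged: the commutators are now the inverses of
  -- `[y, x]` and of `[[y, x], y]`. As `[y, x] ^ N = 1`, the correction terms vanish.
  obtain ⟨-, h3, h4⟩ := mul_pow_collect hxy hcy (fun h => (he h).inv_left) N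
  rw [inv_pow (commElt y x), hcN, inv_one, one_mul, mul_one] at h3
  rw [inv_pow (commElt y x), hcN, pow_choose_two_eq_one hN (mul_eq_left.1 h3.symm), inv_one,
    mul_one, mul_one] at h4
  exact h4.symm

end ThreeStep

/-! ### Necessary conditions for capability -/

section Capable

variable {G : Type u} [Group G]

/-- In a capable group of class at most two, generators `a` and `b` have the same odd exponents. -/
lemma IsCapable.pow_eq_one (hG : IsCapable G) {a b : G} (hgen : Subgroup.closure {a, b} = ⊤)
    (hc : ∀ g, Commute (commElt b a) g) {N : ℕ} (hN : Odd N) (ha : a ^ N = 1) : b ^ N = 1 := by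
  obtain ⟨H, _, ⟨e⟩⟩ := hG
  let f : H →* G := e.symm.toMonoidHom.comp (QuotientGroup.mk' (Subgroup.center H))
  have hf : Function.Surjective f :=
    e.symm.surjective.comp (QuotientGroup.mk'_surjective _)
  have hker : ∀ h, f h = 1 ↔ ∀ g, Commute h g := by
    intro h
    have h1 : f h = 1 ↔ h ∈ Subgroup.center H := by
      rw [← QuotientGroup.eq_one_iff]
      exact map_eq_one_iff e.symm e.symm.injective
    rw [h1, Subgroup.mem_center_iff]
    exact forall_congr' fun g => eq_comm
  obtain ⟨x, rfl⟩ := hf a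
  obtain ⟨y, rfl⟩ := hf b
  rw [← map_commElt] at hc
  have hcen : ∀ z, ∀ h, Commute (commElt (commElt y x) z) h := by
    intro z
    rw [← hker, map_commElt, commElt_eq_one_iff]
    exact hc _
  rw [← map_pow, hker] at ha ⊢
  have hy := commute_pow_of_commute_pow (hcen x) (hcen y) hN ha
  -- The centralizer of `y ^ N` contains lifts of both generators, so it maps onto `G`; every
  -- element of `H` is then one of its elements times a central one.
  have htop : (Subgroup.centralizer {y ^ N}).map f = ⊤ := by
    rw [eq_top_iff, ← hgen, Subgroup.closure_le]
    rintro z (rfl | rfl)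
    · exact ⟨x, Subgroup.mem_centralizer_singleton_iff.2 hy.symm.eq, rfl⟩
    · exact ⟨y, Subgroup.mem_centralizer_singleton_iff.2 (Commute.self_pow y N).eq, rfl⟩
  intro h
  obtain ⟨z, hz, hzh⟩ : f h ∈ (Subgroup.centralizer {y ^ N}).map f := htop ▸ Subgroup.mem_top _
  have h1 : f (z⁻¹ * h) = 1 := by rw [map_mul, map_inv, hzh, inv_mul_cancel]
  have h2 : Commute (y ^ N) z := (Subgroup.mem_centralizer_singleton_iff.1 hz).symm
  have h3 := h2.mul_right ((hker _).1 h1 (y ^ N)).symm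
  rwa [mul_inv_cancel_left] at h3

lemma IsCapable.orderOf_eq {p : ℕ} (hodd : Odd p) [hp : Fact p.Prime] [Finite G] (hG : IsCapable G)
    (hGp : IsPGroup p G) {a b : G} (hgen : Subgroup.closure {a, b} = ⊤)
    (hc : ∀ g, Commute (commElt b a) g) : orderOf a = orderOf b := by
  have hord : ∀ g : G, Odd (orderOf g) := by
    intro g
    obtain ⟨n, hn⟩ := IsPGroup.iff_orderOf.1 hGp g
    rw [hn]
    exact hodd.pow
  apply Nat.dvd_antisymm
  · refine orderOf_dvd_of_pow_eq_one (hG.pow_eq_one ?_ ?_ (hord b) (pow_orderOf_eq_one b))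
    · rwa [Set.pair_comm]
    · intro g
      rw [← commElt_inv]
      exact (hc g).inv_left
  · exact orderOf_dvd_of_pow_eq_one (hG.pow_eq_one hgen hc (hord a) (pow_orderOf_eq_one a))

/-- The pair `1`, `g` generates a cyclic group with generator `g`, and `1` has exponent one; hence
`g ^ 1 = 1`. -/
lemma IsCapable.not_isCyclic [Nontrivial G] (hG : IsCapable G) : ¬ IsCyclic G := by
  intro hcyc
  obtain ⟨g, hg⟩ := IsCyclic.exists_generator (α := G)
  have hcomm : ∀ a b : G, Commute a b := fun a b => by
    let := IsCyclic.commGroup (α := G)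
    exact Commute.all a b
  have hgen : Subgroup.closure {(1 : G), g} = ⊤ := by
    rw [eq_top_iff]
    intro z _
    obtain ⟨n, rfl⟩ := hg z
    exact zpow_mem (Subgroup.subset_closure (by simp)) n
  have h1 := hG.pow_eq_one hgen (fun _ => hcomm _ _) odd_one (one_pow 1)
  obtain ⟨z, hz⟩ := exists_ne (1 : G)
  obtain ⟨n, rfl⟩ := hg z
  rw [pow_one] at h1
  simp [h1] at hz

end Capable
-- Cyclic and two-generated abelian `p`-groups
section Arithmetic

/-- In a cyclic `p`-group, an element of order `p ^ t` is a power, with exponent prime to `p`, of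
the standard element of that order. -/
lemma exists_eq_pow_pow_of_mem_zpowers {G : Type*} [Group G] {p γ t : ℕ} (hp : p.Prime) {c x : G}
    (hc : orderOf c = p ^ γ) (hx : x ∈ Subgroup.zpowers c) (ht : orderOf x = p ^ t) :
    t ≤ γ ∧ ∃ v : ℕ, v.Coprime p ∧ x = (c ^ p ^ (γ - t)) ^ v := by
  have htγ : t ≤ γ := by
    have h1 : orderOf x ∣ orderOf c := orderOf_dvd_of_mem_zpowers hx
    rw [ht, hc] at h1
    exact (Nat.pow_dvd_pow_iff_le_right hp.one_lt).1 h1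
  refine ⟨htγ, ?_⟩
  have hfin : IsOfFinOrder c := orderOf_pos_iff.1 (hc ▸ pow_pos hp.pos _)
  obtain ⟨n, rfl : c ^ n = x⟩ := hfin.mem_powers_iff_mem_zpowers.2 hx
  have hpow : ∀ m : ℕ, c ^ m = 1 ↔ p ^ γ ∣ m := fun m => by
    rw [← hc, orderOf_dvd_iff_pow_eq_one]
  have hpow' : ∀ m : ℕ, (c ^ n) ^ m = 1 ↔ p ^ t ∣ m := fun m => by
    rw [← ht]; exact orderOf_dvd_iff_pow_eq_one.symm
  rcases eq_or_ne (c ^ n) 1 with h1 | h1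
  · refine ⟨1, Nat.coprime_one_left p, ?_⟩
    have h2 : t = 0 := by
      have : p ^ t = 1 := by rw [← ht]; exact orderOf_eq_one_iff.2 h1
      exact (Nat.pow_eq_one.1 this).resolve_left hp.one_lt.ne'
    simp [h1, h2, ← hc, pow_orderOf_eq_one]
  · have hn : n ≠ 0 := by rintro rfl; exact h1 (pow_zero c)
    obtain ⟨k, v, hv, rfl⟩ := Nat.exists_eq_pow_mul_and_not_dvd hn p hp.ne_one
    have hcop : v.Coprime p := (hp.coprime_iff_not_dvd.2 hv).symm
    have hcv : ∀ m, p ^ γ ∣ p ^ m * v ↔ γ ≤ m := fun m => by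
      rw [(hcop.symm.pow_left γ).dvd_mul_right, Nat.pow_dvd_pow_iff_le_right hp.one_lt]
    have hkγ : ¬ γ ≤ k := by rwa [← hcv, ← hpow]
    -- With `n = p^k v`, this says that `c^n` has order `p^(γ-k)`, whence `k = γ - t`.
    have hkey : ∀ m, t ≤ m ↔ γ ≤ k + m := fun m => by
      rw [← hcv, ← Nat.pow_dvd_pow_iff_le_right hp.one_lt, ← hpow', ← pow_mul, hpow, pow_add]
      rw [mul_right_comm]
    refine ⟨v, hcop, ?_⟩
    have h3 := (hkey t).1 le_rfl
    have h4 := (hkey (γ - k)).2 (by omega)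
    rw [show γ - t = k by omega, ← pow_mul]

/-- In an abelian `p`-group, the element `a` can be modified by a power of an element `b` of larger
order so as to be independent of it. -/
lemma exists_independent {A : Type*} [CommGroup A] [Finite A] {p : ℕ} [Fact p.Prime]
    (hA : IsPGroup p A) (a b : A) (hab : orderOf a ∣ orderOf b) :
    ∃ (m : ℤ) (r s : ℕ), r ≤ s ∧ ∀ i j : ℤ, (a * b ^ m) ^ i * b ^ j = 1 ↔
      ((p ^ r : ℕ) : ℤ) ∣ i ∧ ((p ^ s : ℕ) : ℤ) ∣ j := by
  have hp : p.Prime := Fact.out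
  obtain ⟨s, hs⟩ := IsPGroup.iff_orderOf.1 hA b
  obtain ⟨r, hr⟩ := IsPGroup.iff_orderOf.1 (hA.to_quotient (Subgroup.zpowers b))
    (a : A ⧸ Subgroup.zpowers b)
  have hr' : ∀ i : ℤ, a ^ i ∈ Subgroup.zpowers b ↔ ((p ^ r : ℕ) : ℤ) ∣ i := fun i => by
    rw [← QuotientGroup.eq_one_iff, QuotientGroup.mk_zpow, ← hr, orderOf_dvd_iff_zpow_eq_one]
  have hs' : ∀ j : ℤ, b ^ j = 1 ↔ ((p ^ s : ℕ) : ℤ) ∣ j := fun j => by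
    rw [← hs, orderOf_dvd_iff_zpow_eq_one]
  have has : a ^ p ^ s = 1 := by rwa [← orderOf_dvd_iff_pow_eq_one, ← hs]
  have hrs : r ≤ s := by
    rw [← Nat.pow_dvd_pow_iff_le_right hp.one_lt, ← Int.natCast_dvd_natCast, ← hr', zpow_natCast,
      has]
    exact one_mem _
  obtain ⟨n, hn⟩ := (hr' (p ^ r : ℕ)).2 dvd_rfl
  change b ^ n = _ at hn
  have hps : (p : ℤ) ^ s = p ^ r * p ^ (s - r) := by rw [← pow_add]; congr 1; omega
  -- Raising `b^n = a^(p^r)` to the power `p^(s-r)` gives `b^(n p^(s-r)) = a^(p^s) = 1`, so `p^s ∣ n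
  -- p^(s-r)`. Hence `b^n` is a `p^r`-th power of a power of `b`, which can be divided out of `a`.
  obtain ⟨n', hn'⟩ : ((p ^ r : ℕ) : ℤ) ∣ n := by
    have h1 : b ^ (n * (p ^ (s - r) : ℕ)) = 1 := by
      rw [zpow_mul, hn, ← zpow_mul, ← has, ← zpow_natCast a]
      congr 1
      push_cast
      exact hps.symm
    rw [hs'] at h1
    push_cast at h1 ⊢
    rw [hps] at h1
    exact Int.dvd_of_mul_dvd_mul_right (pow_ne_zero _ (by exact_mod_cast hp.ne_zero)) h1
  have hone : (a * b ^ (-n')) ^ (p ^ r) = 1 := by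
    rw [mul_pow, ← zpow_natCast a, ← hn, hn', ← zpow_natCast (b ^ _), ← zpow_mul, ← zpow_add]
    convert zpow_zero b using 2
    ring
  refine ⟨-n', r, s, hrs, fun i j => ⟨fun h => ?_, fun ⟨hi, hj⟩ => ?_⟩⟩
  · have hi : ((p ^ r : ℕ) : ℤ) ∣ i := by
      rw [← hr']
      refine ⟨-(-n' * i + j), ?_⟩
      change b ^ _ = _
      rw [mul_zpow, ← zpow_mul, mul_assoc, ← zpow_add] at h
      rw [zpow_neg, eq_comm]
      exact eq_inv_of_mul_eq_one_left h
    rw [zpow_eq_one_of_dvd hone hi, one_mul, hs'] at h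
    exact ⟨hi, h⟩
  · rw [zpow_eq_one_of_dvd hone hi, one_mul, hs']
    exact hj

end Arithmetic

/-! ### Construction of a standard pair -/

section Generators

variable {G : Type*} [Group G]

lemma commElt_eq_of_mul_eq {a b c : G} (h : b * a = a * b * c) : commElt b a = c := by
  rw [mul_eq_mul_commElt] at h
  exact mul_left_cancel h

lemma commElt_mul_zpow_left {a b : G} (u : ℤ) (hc : ∀ g, Commute (commElt b a) g) :
    commElt (b * a ^ u) a = commElt b a := by
  apply commElt_eq_of_mul_eq
  calc b * a ^ u * a = (b * a) * a ^ u := by group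
    _ = a * b * (commElt b a * a ^ u) := by rw [mul_eq_mul_commElt a b]; group
    _ = _ := by rw [(hc _).eq]; group

lemma commElt_zpow_left {a b : G} (v : ℤ) (hc : ∀ g, Commute (commElt b a) g) :
    commElt (b ^ v) a = commElt b a ^ v := by
  apply commElt_eq_of_mul_eq
  simpa using zpow_mul_zpow_eq hc 1 v

lemma closure_pair_eq_top {a b a' b' : G} (h : Subgroup.closure {a, b} = ⊤)
    (ha : a ∈ Subgroup.closure {a', b'}) (hb : b ∈ Subgroup.closure {a', b'}) :
    Subgroup.closure {a', b'} = ⊤ := by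
  rw [eq_top_iff, ← h, Subgroup.closure_le]
  rintro z (rfl | rfl) <;> assumption

lemma closure_mul_zpow_left {a b : G} (h : Subgroup.closure {a, b} = ⊤) (u : ℤ) :
    Subgroup.closure {a * b ^ u, b} = ⊤ := by
  have hb : b ∈ Subgroup.closure {a * b ^ u, b} := Subgroup.subset_closure (by simp)
  have ha : a * b ^ u ∈ Subgroup.closure {a * b ^ u, b} := Subgroup.subset_closure (by simp)
  refine closure_pair_eq_top h ?_ hb
  simpa using mul_mem ha (inv_mem (zpow_mem hb u))

/-- Modulo the central subgroup generated by `commElt b a` the two generators commute, so the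
quotient is abelian. -/
lemma commutator_le_zpowers {a b : G} (h : Subgroup.closure {a, b} = ⊤)
    (hc : ∀ g, Commute (commElt b a) g) : commutator G ≤ Subgroup.zpowers (commElt b a) := by
  have hn : (Subgroup.zpowers (commElt b a)).Normal := by
    constructor
    rintro _ ⟨n, rfl⟩ g
    change g * commElt b a ^ n * g⁻¹ ∈ _
    rw [← ((hc g).zpow_left n).eq, mul_inv_cancel_right]
    exact ⟨n, rfl⟩
  have hgen : Subgroup.closure {(a : G ⧸ Subgroup.zpowers (commElt b a)), (b : G ⧸ _)} = ⊤ := by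
    have := congrArg (Subgroup.map (QuotientGroup.mk' (Subgroup.zpowers (commElt b a)))) h
    rw [MonoidHom.map_closure, Set.image_pair,
      Subgroup.map_top_of_surjective _ (QuotientGroup.mk'_surjective _)] at this
    exact this
  have hba : Commute (b : G ⧸ Subgroup.zpowers (commElt b a)) (a : G ⧸ _) := by
    rw [← commElt_eq_one_iff]
    exact (QuotientGroup.eq_one_iff (commElt b a)).2 (Subgroup.mem_zpowers _)
  have ha := commute_of_closure hgen (Commute.refl _) hba.symm
  have hb := commute_of_closure hgen hba (Commute.refl _)
  rw [← Subgroup.Normal.quotient_commutative_iff_commutator_le]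
  exact ⟨⟨fun g h => (commute_of_closure hgen (ha g).symm (hb g).symm h).eq⟩⟩

open scoped commutatorElement in
lemma commElt_mem_commutator (a b : G) : commElt a b ∈ commutator G := by
  have : commElt a b = ⁅a⁻¹, b⁻¹⁆ := by simp [commElt, commutatorElement_def]
  rw [this]
  exact Subgroup.commutator_mem_commutator (Subgroup.mem_top _) (Subgroup.mem_top _)

/-- Generators whose images are a basis of the abelianization, with a basis ordered by size. -/
lemma exists_gens_basis [Finite G] {p : ℕ} [hp : Fact p.Prime] (hGp : IsPGroup p G)
    (hgen : ∃ x y : G, Subgroup.closure {x, y} = ⊤) :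
    ∃ (a b : G) (r s : ℕ), Subgroup.closure {a, b} = ⊤ ∧ r ≤ s ∧
      ∀ i j : ℤ, a ^ i * b ^ j ∈ commutator G ↔
        ((p ^ r : ℕ) : ℤ) ∣ i ∧ ((p ^ s : ℕ) : ℤ) ∣ j := by
  obtain ⟨a, b, hgen, hab⟩ : ∃ a b : G, Subgroup.closure {a, b} = ⊤ ∧
      orderOf (Abelianization.of a) ∣ orderOf (Abelianization.of b) := by
    obtain ⟨x, y, h⟩ := hgen
    have hA : IsPGroup p (Abelianization G) := hGp.to_quotient _
    obtain ⟨k, hk⟩ := IsPGroup.iff_orderOf.1 hA (Abelianization.of x)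
    obtain ⟨l, hl⟩ := IsPGroup.iff_orderOf.1 hA (Abelianization.of y)
    rcases le_total k l with hkl | hkl
    · exact ⟨x, y, h, by rw [hk, hl]; exact pow_dvd_pow p hkl⟩
    · exact ⟨y, x, by rwa [Set.pair_comm], by rw [hk, hl]; exact pow_dvd_pow p hkl⟩
  obtain ⟨m, r, s, hrs, H⟩ := exists_independent (hGp.to_quotient _) _ _ hab
  refine ⟨a * b ^ m, b, r, s, closure_mul_zpow_left hgen m, hrs, fun i j => ?_⟩
  rw [← H, ← QuotientGroup.eq_one_iff]
  rfl

/-- If any two generators have the same order then there is a standard pair of generators. -/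
lemma exists_isStdPair [Finite G] {p : ℕ} [hp : Fact p.Prime] (hodd : Odd p) (hGp : IsPGroup p G)
    (hgen : ∃ x y : G, Subgroup.closure {x, y} = ⊤) (hc : ∀ a b g : G, Commute (commElt b a) g)
    (hord : ∀ a b : G, Subgroup.closure {a, b} = ⊤ → orderOf a = orderOf b) :
    ∃ a b : G, IsStdPair p a b := by
  obtain ⟨a, b, r, s, hab, hrs, H⟩ := exists_gens_basis hGp hgen
  obtain ⟨γ, hγ⟩ := IsPGroup.iff_orderOf.1 hGp (commElt b a)
  obtain ⟨N, hN⟩ := IsPGroup.iff_orderOf.1 hGp a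
  have hp1 := hp.out.one_lt
  have hcγ : ∀ k : ℤ, commElt b a ^ k = 1 ↔ ((p ^ γ : ℕ) : ℤ) ∣ k := fun k => by
    rw [← hγ, orderOf_dvd_iff_zpow_eq_one]
  have har : a ^ p ^ r ∈ commutator G := by
    simpa only [zpow_zero, mul_one, zpow_natCast] using (H (p ^ r : ℕ) 0).2 ⟨dvd_rfl, dvd_zero _⟩
  have hbs : b ^ p ^ s ∈ commutator G := by
    simpa only [zpow_zero, one_mul, zpow_natCast] using (H 0 (p ^ s : ℕ)).2 ⟨dvd_zero _, dvd_rfl⟩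
  have hle := commutator_le_zpowers hab (hc a b)
  -- `a^(p^r)` lies in the central derived subgroup, so its commutator with `b`, which is `commElt b
  -- a ^ p^r`, is trivial.
  have hγr : γ ≤ r := by
    obtain ⟨n, hn⟩ := hle har
    have h1 : Commute (a ^ p ^ r) b := by rw [← hn]; exact (hc a b b).zpow_left n
    have h2 := zpow_mul_zpow_eq (hc a b) (p ^ r : ℕ) 1
    rw [zpow_one, mul_one, zpow_natCast, zpow_natCast, h1.eq, left_eq_mul, ← zpow_natCast,
      hcγ, Int.natCast_dvd_natCast] at h2
    exact (Nat.pow_dvd_pow_iff_le_right hp1).1 h2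
  have hNb : orderOf b = p ^ N := by rw [← hord a b hab, hN]
  -- an element whose order modulo the derived subgroup is `p ^ k` has order at least `p ^ k`
  have hrN : r ≤ N := by
    have h1 := (H (p ^ N : ℕ) 0).1 (by
      rw [zpow_zero, mul_one, zpow_natCast, ← hN, pow_orderOf_eq_one]; exact one_mem _)
    exact (Nat.pow_dvd_pow_iff_le_right hp1).1 (Int.natCast_dvd_natCast.1 h1.1)
  have hsN : s ≤ N := by
    have h1 := (H 0 (p ^ N : ℕ)).1 (by
      rw [zpow_zero, one_mul, zpow_natCast, ← hNb, pow_orderOf_eq_one]; exact one_mem _)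
    exact (Nat.pow_dvd_pow_iff_le_right hp1).1 (Int.natCast_dvd_natCast.1 h1.2)
  have hordpow : ∀ g : G, orderOf g = p ^ N → ∀ k ≤ N, orderOf (g ^ p ^ k) = p ^ (N - k) := by
    intro g hg k hk
    rw [orderOf_pow_of_dvd (pow_ne_zero _ hp.out.ne_zero) (by rw [hg]; exact pow_dvd_pow p hk), hg,
      Nat.pow_div hk hp.out.pos]
  -- make the second generator of order `p ^ s`
  obtain ⟨u, hu⟩ : ∃ u : ℤ, b ^ p ^ s = (a ^ p ^ s) ^ u := by
    have has : a ^ p ^ s ∈ commutator G := by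
      have := pow_mem har (p ^ (s - r))
      rwa [← pow_mul, ← pow_add, Nat.add_sub_cancel' hrs] at this
    -- `a^(p^s)` and `b^(p^s)` have the same order `p^(N-s)` in a cyclic `p`-group, so they generate
    -- the same subgroup.
    obtain ⟨-, v, -, hv⟩ := exists_eq_pow_pow_of_mem_zpowers hp.out hγ (hle hbs)
      (hordpow b hNb s hsN)
    obtain ⟨-, w, hw, hw'⟩ := exists_eq_pow_pow_of_mem_zpowers hp.out hγ (hle has)
      (hordpow a hN s hsN)
    have hmem : commElt b a ^ p ^ (γ - (N - s)) ∈ Subgroup.zpowers (a ^ p ^ s) := by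
      rw [hw']
      set z := commElt b a ^ p ^ (γ - (N - s))
      have hz : w.Coprime (orderOf z) := by
        refine Nat.Coprime.coprime_dvd_right (orderOf_pow_dvd _) ?_
        rw [hγ]
        exact hw.pow_right γ
      exact mem_zpowers_pow_iff.2 hz
    obtain ⟨u, hu⟩ := pow_mem hmem v
    exact ⟨u, by rw [hv]; exact hu.symm⟩
  have hcC : ∀ x y : G, commElt x y ^ p ^ s = 1 := by
    intro x y
    obtain ⟨n, hn⟩ := hle (commElt_mem_commutator x y)
    change commElt b a ^ n = _ at hn
    rw [← hn, ← zpow_natCast, ← zpow_mul, hcγ]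
    exact (Int.natCast_dvd_natCast.2 (pow_dvd_pow p (hγr.trans hrs))).mul_left n
  have hb's : (b * a ^ (-u)) ^ p ^ s = 1 := by
    rw [mul_pow_eq (hc _ _), pow_choose_two_eq_one hodd.pow (hcC _ _), mul_one, hu,
      ← zpow_natCast (a ^ (-u)), ← zpow_natCast a, ← zpow_mul, ← zpow_mul, ← zpow_add]
    convert zpow_zero a using 2
    ring
  have hb'gen : Subgroup.closure {a, b * a ^ (-u)} = ⊤ := by
    rw [Set.pair_comm] at hab ⊢
    exact closure_mul_zpow_left hab (-u)
  -- The corrected pair still generates, so the equal-order hypothesis gives the new element order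
  -- `p^N`, while its `p^s`-th power is trivial.
  have hNs : N = s := by
    refine le_antisymm ?_ hsN
    rw [← Nat.pow_dvd_pow_iff_le_right hp1, ← hN, hord _ _ hb'gen]
    exact orderOf_dvd_of_pow_eq_one hb's
  subst hNs
  have hb'c : commElt (b * a ^ (-u)) a = commElt b a := commElt_mul_zpow_left _ (hc a b)
  have H' : ∀ i j : ℤ, a ^ i * (b * a ^ (-u)) ^ j ∈ commutator G →
      ((p ^ r : ℕ) : ℤ) ∣ i ∧ ((p ^ N : ℕ) : ℤ) ∣ j := by
    intro i j hij
    have h1 : a ^ (i - u * j) * b ^ j ∈ commutator G := by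
      rw [← Abelianization.ker_of, MonoidHom.mem_ker] at hij ⊢
      rw [← hij]
      simp only [map_mul, map_zpow]
      rw [zpow_sub, mul_zpow, ← zpow_mul, neg_mul, zpow_neg, mul_assoc,
        mul_comm (Abelianization.of b ^ j)]
    obtain ⟨h2, h3⟩ := (H _ _).1 h1
    refine ⟨?_, h3⟩
    have h4 := ((Int.natCast_dvd_natCast.2 (pow_dvd_pow p hrs)).trans h3).mul_left u
    simpa using dvd_add h2 h4
  -- scale the second generator
  obtain ⟨hσ, v, hv, hav⟩ := exists_eq_pow_pow_of_mem_zpowers hp.out hγ (hle har)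
    (hordpow a hN r hrN)
  have hcop : ∀ n : ℕ, IsCoprime ((p ^ n : ℕ) : ℤ) (-v : ℤ) := fun n =>
    (Nat.isCoprime_iff_coprime.2 (hv.symm.pow_left n)).neg_right
  set b' := b * a ^ (-u) with hb'
  have hc' : commElt (b' ^ (-v : ℤ)) a = commElt b a ^ (-v : ℤ) := by
    rw [commElt_zpow_left _ (hc _ _), hb'c]
  have hr : N + (γ - (N - r)) - γ = r := by omega
  -- Here `α = β = N` and `σ = γ - (N - r)`, so `α + σ - γ = r`. The exponent `-v` replaces `c` by
  -- `c^(-v)`, turning `a^(p^r) = c^(p^σ v)` into the last relation; `v` is prime to `p`, so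
  -- generation is preserved.
  refine ⟨a, b' ^ (-v : ℤ), N, N, γ, γ - (N - r), ⟨by omega, by omega, by omega, by omega,
    fun _ => le_rfl⟩, StdRelations.exists_mulEquiv ⟨?_, ?_, ?_, hc _ _ _, hc _ _ _, ?_⟩ ?_ ?_ ?_⟩
  · rw [← hN, pow_orderOf_eq_one]
  · rw [← zpow_natCast, zpow_comm, zpow_natCast, hb's, one_zpow]
  · rw [hc', ← zpow_natCast, ← zpow_mul, hcγ]
    exact dvd_mul_left _ _
  · rw [hr, hc', hav, ← zpow_natCast _ v, ← zpow_natCast, ← zpow_natCast, ← zpow_mul, ← zpow_mul,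
      ← zpow_add]
    convert zpow_zero _ using 2
    ring
  · refine closure_pair_eq_top hb'gen (Subgroup.subset_closure (by simp)) ?_
    have h1 : b' ^ (-v : ℤ) ∈ Subgroup.closure {a, b' ^ (-v : ℤ)} :=
      Subgroup.subset_closure (by simp)
    have h2 : b' ∈ Subgroup.zpowers (b' ^ v) := by
      rw [mem_zpowers_pow_iff]
      exact Nat.Coprime.coprime_dvd_right (orderOf_dvd_of_pow_eq_one hb's) (hv.pow_right N)
    refine (Subgroup.zpowers_le.2 ?_) h2
    simpa using inv_mem h1
  · intro i j k hijk
    rw [hr]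
    have h1 : a ^ i * b' ^ (-v * j : ℤ) ∈ commutator G := by
      rw [zpow_mul, eq_inv_of_mul_eq_one_left hijk]
      exact inv_mem (zpow_mem (commElt_mem_commutator _ _) _)
    obtain ⟨h2, h3⟩ := H' _ _ h1
    exact ⟨h2, (hcop N).dvd_of_dvd_mul_left h3⟩
  · intro k hk
    rw [hc', ← zpow_mul, hcγ] at hk
    exact (hcop γ).dvd_of_dvd_mul_left hk

end Generators
end CapableTwoGen

theorem mainTheorem6 {p : ℕ} (hp : p.Prime) (hodd : Odd p)
    {G : Type u} [Group G] [Finite G] [Nontrivial G] (hG : IsPGroup p G)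
    (hclass : Subgroup.lowerCentralSeries (⊤ : Subgroup G) 2 = ⊥)
    (hgen : ∃ x y : G, Subgroup.closure {x, y} = ⊤) :
    (CapableTwoGen.IsCapable G ↔
      ¬ IsCyclic G ∧ ∃ a b : G, CapableTwoGen.IsStdPair p a b ∧ orderOf a = orderOf b) ∧
    (∀ a b : G, CapableTwoGen.IsStdPair p a b →
      (CapableTwoGen.IsCapable G ↔ ¬ IsCyclic G ∧ orderOf a = orderOf b)) := by
  have hpf : Fact p.Prime := ⟨hp⟩
  have hc : ∀ a b g : G, Commute (CapableTwoGen.commElt b a) g := by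
    intro a b g
    have h1 := CapableTwoGen.commElt_mem_commutator b a
    rw [← Subgroup.top_lowerCentralSeries_one] at h1
    have h2 := Subgroup.commutator_mem_commutator h1 (Subgroup.mem_top g)
    rw [← Subgroup.lowerCentralSeries_succ, hclass, Subgroup.mem_bot] at h2
    exact commutatorElement_eq_one_iff_commute.1 h2
  have hord : CapableTwoGen.IsCapable G → ∀ a b : G, Subgroup.closure {a, b} = ⊤ →
      orderOf a = orderOf b := fun hcap a b hab => hcap.orderOf_eq hodd hG hab (hc a b)
  have hpair : ∀ a b : G, CapableTwoGen.IsStdPair p a b → Subgroup.closure {a, b} = ⊤ := by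
    rintro _ _ ⟨α, β, γ, σ, -, e, rfl, rfl⟩
    have := congrArg (Subgroup.map e.toMonoidHom)
      (CapableTwoGen.StdGroup.closure_eq_top p α β γ σ)
    rwa [MonoidHom.map_closure, Set.image_pair,
      Subgroup.map_top_of_surjective _ e.surjective] at this
  have hsuff : ∀ a b : G, CapableTwoGen.IsStdPair p a b → orderOf a = orderOf b →
      CapableTwoGen.IsCapable G := by
    rintro _ _ ⟨α, β, γ, σ, hpar, e, rfl, rfl⟩ h
    rw [MulEquiv.orderOf_eq, MulEquiv.orderOf_eq, hpar.orderOf_fst hp.ne_zero,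
      hpar.orderOf_snd hp.ne_zero] at h
    obtain rfl := Nat.pow_right_injective hp.two_le h
    exact hpar.isCapable hp hodd e
  refine ⟨⟨fun hcap => ⟨hcap.not_isCyclic, ?_⟩, fun ⟨_, a, b, hab, h⟩ => hsuff a b hab h⟩,
    fun a b hab => ⟨fun hcap => ⟨hcap.not_isCyclic, hord hcap a b (hpair a b hab)⟩,
      fun ⟨_, h⟩ => hsuff a b hab h⟩⟩
  obtain ⟨a, b, hab⟩ := CapableTwoGen.exists_isStdPair hodd hG hgen hc (hord hcap)
  exact ⟨a, b, hab, hord hcap a b (hpair a b hab)⟩
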